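/- For every $\varepsilon>0$ there is a constant $C_\varepsilon>0$ such that for every real-valued $W\in L^2(\mathbb{R}^3)$ whose Fourier transform $\widehat W(k)=\int_{\mathbb{R}^3}W(x)e^{-ik\cdot x}\,dx$ (understood in the $L^2$ sense) belongs to $L^\infty(\mathbb{R}^3)$, the two operator inequalities $$\pm W(x-y)\le C_\varepsilon\,\|\widehat W\|_{L^\infty(\mathbb{R}^3)}\,(1-\Delta_x)^{3/4+\varepsilon}\otimes(1-\Delta_y)^{3/4+\varepsilon}$$ hold on $L^2(\mathbb{R}^3\times\mathbb{R}^3)$. The constant $C_\varepsilon$ depends only on $\varepsilon$ and not on $W$. Here $W(x-y)$ is the multiplication operator by this function, $(1-\Delta_x)^{s}\otimes(1-\Delta_y)^{s}$ is the Fourier multiplier with symbol $(1+|p|^2)^{s}(1+|q|^2)^{s}$ (with $p,q$ the variables dual to $x,y$), and the inequalities are meant in the sense of quadratic forms: with $s=3/4+\varepsilon$, for every $\psi\in L^2(\mathbb{R}^3\times\mathbb{R}^3)$ in the form domain of $(1-\Delta_x)^{s}\otimes(1-\Delta_y)^{s}$ the function $W(x-y)|\psi(x,y)|^2$ is integrable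 and $$\pm\iint W(x-y)|\psi(x,y)|^2\,dx\,dy\le C_\varepsilon\,\|\widehat W\|_{L^\infty(\mathbb{R}^3)}\,\big\langle\psi,(1-\Delta_x)^{s}\otimes(1-\Delta_y)^{s}\psi\big\rangle ,$$ the last bracket denoting the quadratic form. -/

import Mathlib

open MeasureTheory
open scoped FourierTransform ENNReal

/-- The configuration space `ℝ³` of one particle. -/
abbrev R3 : Type := EuclideanSpace ℝ (Fin 3)

/-- The configuration space `ℝ³ × ℝ³` of two particles `z = (x, y)`, with its Euclidean structure
(and hence Lebesgue measure, the product of the two Lebesgue measures). -/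
abbrev R3xR3 : Type := WithLp 2 (R3 × R3)

/-- The Hilbert space `L²(ℝ³ × ℝ³; ℂ) = L²(ℝ³) ⊗ L²(ℝ³)` of two-particle wave functions. -/
abbrev TwoBody : Type := Lp ℂ 2 (volume : Measure R3xR3)

/-- A real quadratic form on the two-particle space together with its form domain. -/
structure TwoBodyForm where
  dom : Set TwoBody
  val : TwoBody → ℝ

namespace TwoBodyForm

/-- The operator inequality `A ≤ B` in the sense of quadratic forms: `Q(B) ⊆ Q(A)` and
`⟨ψ, A ψ⟩ ≤ ⟨ψ, B ψ⟩` for every `ψ ∈ Q(B)`. -/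
def OpLE (A B : TwoBodyForm) : Prop :=
  ∀ ψ ∈ B.dom, ψ ∈ A.dom ∧ A.val ψ ≤ B.val ψ

/-- The form `c A` with the form domain of `A`. -/
def scale (c : ℝ) (A : TwoBodyForm) : TwoBodyForm where
  dom := A.dom
  val := fun ψ => c * A.val ψ

/-- The quadratic form of the self-adjoint operator of multiplication by the real function `V`:
the form domain is `{ψ ∈ L² : ∫ |V| |ψ|² < ∞}` and the value is `∫ V |ψ|²`. -/
noncomputable def multiplication (V : R3xR3 → ℝ) : TwoBodyForm where
  dom := {ψ | Integrable (fun z => V z * ‖ψ z‖ ^ 2) volume}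
  val := fun ψ => ∫ z, V z * ‖ψ z‖ ^ 2

/-- The quadratic form of the Fourier multiplier `𝓕⁻¹ m 𝓕` with the real symbol `m`, i.e. of the
self-adjoint operator which is unitarily equivalent, through the Fourier transform of
`L²(ℝ³ × ℝ³)`, to the multiplication by `m`. -/
noncomputable def fourierMultiplier (m : R3xR3 → ℝ) : TwoBodyForm where
  dom := {ψ | 𝓕 ψ ∈ (multiplication m).dom}
  val := fun ψ => (multiplication m).val (𝓕 ψ)

end TwoBodyForm

/-- The symbol of `(1 - Δ)^s` on `ℝ³`. With the Fourier transform `∫ f(x) e^{-2πi⟨x, ξ⟩} dx`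
the operator `-Δ` is the multiplication by `(2π|ξ|)²`. -/
noncomputable def oneSubLaplacianPowSymbol (s : ℝ) (ξ : R3) : ℝ :=
  (1 + (2 * Real.pi * ‖ξ‖) ^ 2) ^ s

/-- The (form of the) operator `(1 - Δ_x)^s ⊗ (1 - Δ_y)^t` on `L²(ℝ³) ⊗ L²(ℝ³) = L²(ℝ³ × ℝ³)`:
the tensor product of two Fourier multipliers is the Fourier multiplier with the product symbol
`(ξ, η) ↦ a(ξ) b(η)`. -/
noncomputable def oneSubLaplacianPowTensor (s t : ℝ) : TwoBodyForm :=
  TwoBodyForm.fourierMultiplier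
    (fun ζ => oneSubLaplacianPowSymbol s ζ.fst * oneSubLaplacianPowSymbol t ζ.snd)

/-- The (form of the) pair interaction: multiplication by `W(x - y)`. -/
noncomputable def pairInteraction (W : R3 → ℝ) : TwoBodyForm :=
  TwoBodyForm.multiplication (fun z => W (z.fst - z.snd))

/-- The Fourier transform in `L²(ℝ³)` of a real square-integrable function. -/
noncomputable def fourierL2 (W : R3 → ℝ) (hW : MemLp W 2 (volume : Measure R3)) :
    Lp ℂ 2 (volume : Measure R3) :=
  𝓕 (MemLp.toLp (fun x => (W x : ℂ)) hW.ofReal)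

/-! Let `μ` be the distribution of `x - y` under the density `|ψ|²`, `F` its Fourier transform and
`φ = 𝓕 ψ`. Parseval gives `∫ W dμ = ∫ Ŵ F`, so everything reduces to `∫ |F| ≤ C ⟨ψ, (1 - Δ_x)^s ⊗ (1
- Δ_y)^s ψ⟩`, which does not involve `W`.

Multiplying `ψ` by the character of `x - y` at `k` translates `φ` by `(k, -k)`, so `F(k)` is a
correlation of `φ` at fixed total momentum `P`. Hence `∫ |F| ≤ ∫ (∫ |φ(p, P - p)| dp)² dP`.
Cauchy–Schwarz in each fibre, with `w` the symbol of `(1 - Δ)^s`, costs `∫ dp / (w(p) w(P - p)) ≤ 2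
∫ w⁻²`, finite because `4s > 3` (`lintegral_lintegral_relative_shift_le`).

Parseval needs care, as `W` is only in `L²`. Integrability of `F` forces `μ ≤ ‖F‖₁ • volume`
(`measure_le_smul_volume_of_integrable_fourierInvMeasure`), so `L²` functions make sense `μ`-a.e.
and the identity extends from Schwartz functions by density (`integral_eq_integral_fourier_mul`). -/

/-! ### Fourier transforms of finite measures, Parseval, modulations. -/

section FourierMeasure

open Real SchwartzMap

variable {V : Type*} [NormedAddCommGroup V] [InnerProductSpace ℝ V] [MeasurableSpace V]

/-- The inverse Fourier transform `k ↦ ∫ exp (2πi⟪u, k⟫) dμ(u)` of a measure `μ`. -/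
noncomputable def fourierInvMeasure (μ : Measure V) : V → ℂ :=
  VectorFourier.fourierIntegral 𝐞 μ (-innerₗ V) (fun _ => (1 : ℂ))

lemma fourierInvMeasure_apply (μ : Measure V) (k : V) :
    fourierInvMeasure μ k = ∫ u, (𝐞 (inner ℝ u k) : ℂ) ∂μ := by
  simp [fourierInvMeasure, VectorFourier.fourierIntegral, Circle.smul_def]

lemma norm_fourierInvMeasure_le (μ : Measure V) [IsFiniteMeasure μ] (k : V) :
    ‖fourierInvMeasure μ k‖ ≤ μ.real Set.univ := by
  simpa [fourierInvMeasure] using VectorFourier.norm_fourierIntegral_le_integral_norm 𝐞 μ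
    (-innerₗ V) (fun _ => (1 : ℂ)) k

omit [MeasurableSpace V] in
lemma continuous_neg_innerₗ : Continuous fun p : V × V => (-innerₗ V) p.1 p.2 := by
  simp only [LinearMap.neg_apply, innerₗ_apply_apply]
  fun_prop

variable [BorelSpace V] [FiniteDimensional ℝ V]

omit [FiniteDimensional ℝ V] in
lemma continuous_fourierInvMeasure (μ : Measure V) [IsFiniteMeasure μ] :
    Continuous (fourierInvMeasure μ) :=
  VectorFourier.fourierIntegral_continuous continuous_fourierChar
    continuous_neg_innerₗ (integrable_const _)

/-- Parseval's identity for a Schwartz function and a finite measure. -/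
lemma integral_schwartz_eq_integral_fourier_mul (μ : Measure V) [IsFiniteMeasure μ]
    (f : 𝓢(V, ℂ)) : ∫ u, f u ∂μ = ∫ k, 𝓕 f k * fourierInvMeasure μ k := by
  have h := VectorFourier.integral_fourierIntegral_smul_eq_flip (μ := (volume : Measure V))
    (ν := μ) (L := -innerₗ V) (f := (𝓕 f : 𝓢(V, ℂ))) (g := fun _ => (1 : ℂ))
    continuous_fourierChar continuous_neg_innerₗ
    (𝓕 f).integrable (integrable_const _)
  have hflip : (-innerₗ V).flip = -innerₗ V := by
    ext x y
    simp [real_inner_comm]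
  rw [hflip] at h
  simp only [smul_eq_mul, mul_one] at h
  rw [← fourierInvMeasure] at h
  rw [← h]
  -- With the pairing `-⟪·,·⟫` the transform of `𝓕 f` is the inverse transform, so Fourier inversion
  -- closes the goal.
  refine integral_congr_ae (.of_forall fun u => ?_)
  have hinv := congrArg (fun g : 𝓢(V, ℂ) => g u) 
    (FourierTransform.fourierInv_fourier_eq (F := 𝓢(V, ℂ)) f)
  rw [fourierInv_coe] at hinv
  exact hinv.symm

/-- Parseval together with `‖𝓕 f‖_∞ ≤ ‖f‖₁`. The `L¹` norm of `f` on the right is what allows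
comparison with Lebesgue measure. -/
lemma norm_integral_schwartz_le {μ : Measure V} [IsFiniteMeasure μ]
    (hF : Integrable (fourierInvMeasure μ)) (f : 𝓢(V, ℂ)) :
    ‖∫ u, f u ∂μ‖ ≤ (∫ u, ‖f u‖) * ∫ k, ‖fourierInvMeasure μ k‖ := by
  rw [integral_schwartz_eq_integral_fourier_mul, ← integral_const_mul]
  refine norm_integral_le_of_norm_le (hF.norm.const_mul _) (.of_forall fun k => ?_)
  rw [norm_mul]
  gcongr
  rw [fourier_coe]
  exact VectorFourier.norm_fourierIntegral_le_integral_norm _ _ _ _ _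

/-- A finite measure with integrable Fourier transform is bounded by a multiple of Lebesgue
measure. -/
lemma measure_le_smul_volume_of_integrable_fourierInvMeasure {μ : Measure V} [IsFiniteMeasure μ]
    (hF : Integrable (fourierInvMeasure μ)) :
    μ ≤ ENNReal.ofReal (∫ k, ‖fourierInvMeasure μ k‖) • volume := by
  set c := ∫ k, ‖fourierInvMeasure μ k‖
  have hc : 0 ≤ c := integral_nonneg fun _ => norm_nonneg _
  -- Test against a smooth bump equal to `1` on `K` and supported in `U`.
  have hopen : ∀ K U : Set V, IsCompact K → IsOpen U → K ⊆ U → volume U ≠ ∞ →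
      μ K ≤ ENNReal.ofReal c * volume U := by
    intro K U hK hU hKU hUfin
    obtain ⟨O, hO, hKO, hOU, hOc⟩ := exists_open_between_and_isCompact_closure hK hU hKU
    obtain ⟨g, hg, hg01, hgO, hgK⟩ := exists_contMDiff_support_eq_eq_one_iff (n := (⊤ : ℕ∞))
      (modelWithCornersSelf ℝ V) hO hK.isClosed hKO
    rw [contMDiff_iff_contDiff] at hg
    have hg01' : ∀ x, 0 ≤ g x ∧ g x ≤ 1 := fun x => hg01 ⟨x, rfl⟩
    have hcs : HasCompactSupport (fun x => (g x : ℂ)) := by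
      refine HasCompactSupport.of_support_subset_isCompact hOc ?_
      intro x hx
      refine subset_closure (hgO ▸ ?_)
      simpa using hx
    let f : 𝓢(V, ℂ) := hcs.toSchwartzMap (Complex.ofRealCLM.contDiff.comp hg)
    have hf : ∀ x, f x = g x := fun x => rfl
    have key := norm_integral_schwartz_le hF f
    simp only [hf, integral_complex_ofReal, Complex.norm_real] at key
    have hint : ∀ ν : Measure V, IsFiniteMeasureOnCompacts ν → Integrable g ν := fun ν _ =>
      hg.continuous.integrable_of_hasCompactSupport
        (HasCompactSupport.of_support_subset_isCompact hOc (hgO ▸ subset_closure))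
    have h1 : μ.real K ≤ ∫ x, g x ∂μ := by
      rw [← integral_indicator_one hK.measurableSet]
      refine integral_mono ((integrable_const (1 : ℝ)).indicator hK.measurableSet)
        (hint μ inferInstance) fun x => ?_
      by_cases hx : x ∈ K
      · simp [hx, (hgK x).1 hx]
      · simp [hx, (hg01' x).1]
    have h2 : ∫ x, ‖g x‖ ≤ volume.real U := by
      rw [← integral_indicator_one hU.measurableSet]
      refine integral_mono (hint volume inferInstance).norm
        ((integrable_indicator_iff hU.measurableSet).2 (integrableOn_const hUfin)) fun x => ?_
      by_cases hx : x ∈ U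
      · simpa [hx, abs_of_nonneg (hg01' x).1] using (hg01' x).2
      · have : g x = 0 := by
          by_contra h
          exact hx (hOU (subset_closure (hgO ▸ h)))
        simp [this, hx]
    have h3 : μ.real K ≤ c * volume.real U := by
      calc μ.real K ≤ ∫ x, g x ∂μ := h1
        _ ≤ ‖∫ x, g x ∂μ‖ := le_abs_self _
        _ ≤ (∫ x, ‖g x‖) * c := key
        _ ≤ c * volume.real U := by rw [mul_comm]; gcongr
    rw [← ofReal_measureReal (measure_ne_top μ K), ← ofReal_measureReal hUfin,
      ← ENNReal.ofReal_mul hc]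
    exact ENNReal.ofReal_le_ofReal h3
  have hcompact : ∀ K : Set V, IsCompact K → μ K ≤ ENNReal.ofReal c * volume K := by
    intro K hK
    have hlt : volume K < ∞ := hK.measure_lt_top
    -- Outer regularity: the volume of `U` may be taken arbitrarily close to that of `K`.
    have : (nhdsWithin (volume K) (Set.Ioi (volume K))).NeBot := nhdsGT_neBot_of_exists_gt ⟨_, hlt⟩
    refine ge_of_tendsto (x := nhdsWithin (volume K) (Set.Ioi (volume K)))
      (f := fun r => ENNReal.ofReal c * r) ?_ ?_
    · exact (ENNReal.Tendsto.const_mul Filter.tendsto_id (Or.inr ENNReal.ofReal_ne_top)).mono_left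
        nhdsWithin_le_nhds
    · filter_upwards [Ioo_mem_nhdsGT hlt] with r hr
      obtain ⟨U, hKU, hU, hUr⟩ := Set.exists_isOpen_lt_of_lt K r hr.1
      exact (hopen K U hK hU hKU (hUr.trans hr.2).ne).trans (by gcongr)
  refine Measure.le_iff.2 fun A hA => ?_
  rw [hA.measure_eq_iSup_isCompact]
  refine iSup₂_le fun K hKA => iSup_le fun hK => (hcompact K hK).trans ?_
  rw [Measure.smul_apply, smul_eq_mul]
  gcongr

/-- Parseval's identity for a square-integrable function and a finite measure with integrable
Fourier transform. -/
lemma integral_eq_integral_fourier_mul {μ : Measure V} [IsFiniteMeasure μ]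
    (hF : Integrable (fourierInvMeasure μ)) (f : Lp ℂ 2 (volume : Measure V)) :
    ∫ u, f u ∂μ = ∫ k, 𝓕 f k * fourierInvMeasure μ k := by
  have hle := measure_le_smul_volume_of_integrable_fourierInvMeasure hF
  set c := ENNReal.ofReal (∫ k, ‖fourierInvMeasure μ k‖)
  have hc : c ≠ ∞ := ENNReal.ofReal_ne_top
  have hac : μ ≪ volume := Measure.absolutelyContinuous_of_le_smul hle
  -- Bounded by the total mass of `μ` and integrable, hence square-integrable.
  have hFmem : MemLp (fourierInvMeasure μ) 2 (volume : Measure V) := by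
    rw [memLp_two_iff_integrable_sq_norm hF.1]
    refine (hF.norm.const_mul (μ.real Set.univ)).mono' (hF.1.norm.pow 2) (.of_forall fun k => ?_)
    rw [norm_pow, norm_norm, sq]
    gcongr
    exact norm_fourierInvMeasure_le μ k
  -- The domination of `μ` makes `L²(volume) → L²(μ)` continuous. Both sides then become continuous
  -- pairings in `f`, and Schwartz functions suffice.
  let L := Lp.LpToLpOfMeasureLeSMul (E := ℂ) (p := 2) hc hle
  have hone : MemLp (fun _ : V => (1 : ℂ)) 2 μ := memLp_const _
  have hleft : ∀ g : Lp ℂ 2 (volume : Measure V), ∫ u, g u ∂μ =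
      (ContinuousLinearMap.mul ℂ ℂ).lpPairing μ 2 2 (L g) hone.toLp := fun g => by
    rw [ContinuousLinearMap.lpPairing_eq_integral]
    refine integral_congr_ae ?_
    filter_upwards [hone.coeFn_toLp, Lp.coeFn_LpToLpOfMeasureLeSMul hc hle g] with u h1 h2
    rw [ContinuousLinearMap.mul_apply', h1, mul_one]
    exact h2.symm
  have hright : ∀ g : Lp ℂ 2 (volume : Measure V), ∫ k, g k * fourierInvMeasure μ k =
      (ContinuousLinearMap.mul ℂ ℂ).lpPairing volume 2 2 g hFmem.toLp := fun g => by
    rw [ContinuousLinearMap.lpPairing_eq_integral]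
    refine integral_congr_ae ?_
    filter_upwards [hFmem.coeFn_toLp] with u h1
    simp [h1]
  refine DenseRange.induction_on (p := fun f : Lp ℂ 2 (volume : Measure V) =>
      ∫ u, f u ∂μ = ∫ k, 𝓕 f k * fourierInvMeasure μ k)
    (SchwartzMap.denseRange_toLpCLM (p := 2) ENNReal.ofNat_ne_top) f ?_ fun g => ?_
  · simp only [hleft, hright]
    refine isClosed_eq ?_ ?_
    · fun_prop
    · have := FourierTransform.continuous_fourier (E := Lp ℂ 2 (volume : Measure V))
        (F := Lp ℂ 2 (volume : Measure V))
      fun_prop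
  · rw [toLpCLM_apply, toLp_fourier_eq, integral_congr_ae (hac.ae_eq (g.coeFn_toLp 2)),
      integral_schwartz_eq_integral_fourier_mul]
    refine integral_congr_ae ?_
    filter_upwards [(𝓕 g).coeFn_toLp 2] with k hk
    rw [hk]

/-- The character `x ↦ exp (2πi⟪a, x⟫)` as an essentially bounded function. -/
noncomputable def characterLp (a : V) : Lp ℂ ∞ (volume : Measure V) :=
  (memLp_top_of_bound (f := fun x : V => ((𝐞 (inner ℝ a x) : Circle) : ℂ))
    (by fun_prop) 1 (.of_forall fun x => (Circle.norm_coe _).le)).toLp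

lemma coeFn_characterLp (a : V) :
    characterLp a =ᵐ[volume] fun x => ((𝐞 (inner ℝ a x) : Circle) : ℂ) :=
  MemLp.coeFn_toLp _

/-- The Fourier transform turns modulations into translations. -/
lemma fourier_characterLp_smul (a : V) (f : Lp ℂ 2 (volume : Measure V)) :
    𝓕 (characterLp a • f : Lp ℂ 2 (volume : Measure V)) =
      Lp.compMeasurePreserving (fun k => k - a) (measurePreserving_sub_right volume a) (𝓕 f) := by
  refine DenseRange.induction_on (p := fun f : Lp ℂ 2 (volume : Measure V) =>
      𝓕 (characterLp a • f : Lp ℂ 2 (volume : Measure V)) =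
        Lp.compMeasurePreserving (fun k => k - a) (measurePreserving_sub_right volume a) (𝓕 f))
    (SchwartzMap.denseRange_toLpCLM (p := 2) ENNReal.ofNat_ne_top) f ?_ fun g => ?_
  · have h1 := FourierTransform.continuous_fourier (E := Lp ℂ 2 (volume : Measure V))
        (F := Lp ℂ 2 (volume : Measure V))
    refine isClosed_eq (h1.comp ?_) ((Lp.isometry_compMeasurePreserving _).continuous.comp h1)
    exact ((ContinuousLinearMap.lsmul ℂ ℂ).holderL volume ∞ 2 2 (characterLp a)).continuous
  -- The modulated `g` is the inverse transform of the translate `h`, by a shift of variables in the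
  -- inversion integral.
  · let h : 𝓢(V, ℂ) := compSubConstCLM ℂ a (𝓕 g)
    have hmul : (characterLp a • g.toLp 2 volume : Lp ℂ 2 (volume : Measure V)) =
        (𝓕⁻ h).toLp 2 := by
      refine Lp.ext ?_
      filter_upwards [Lp.coeFn_lpSMul (r := 2) (characterLp a) (g.toLp 2 volume),
        coeFn_characterLp a, g.coeFn_toLp 2, (𝓕⁻ h).coeFn_toLp 2] with x h1 h2 h3 h4
      rw [h1, h4, Pi.smul_apply', h2, h3]
      have hinv := congrArg (fun g : 𝓢(V, ℂ) => g x)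
        (FourierTransform.fourierInv_fourier_eq (F := 𝓢(V, ℂ)) g)
      simp only [fourierInv_coe, fourierInv_eq] at hinv ⊢
      rw [← hinv, smul_eq_mul, ← integral_const_mul,
        ← integral_sub_right_eq_self (fun v => _ * (𝐞 (inner ℝ v x) • 𝓕 g v)) a]
      refine integral_congr_ae (.of_forall fun v => ?_)
      have hsplit : (inner ℝ v x : ℝ) = inner ℝ a x + inner ℝ (v - a) x := by
        rw [← inner_add_left]; simp
      simp only [h, compSubConstCLM_apply, Circle.smul_def, smul_eq_mul]
      rw [hsplit, AddChar.map_add_eq_mul, Circle.coe_mul, mul_assoc]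
    rw [toLpCLM_apply, hmul, toLp_fourier_eq, toLp_fourier_eq,
      FourierTransform.fourier_fourierInv_eq]
    refine Lp.ext ?_
    filter_upwards [h.coeFn_toLp 2 volume,
      Lp.coeFn_compMeasurePreserving ((𝓕 g).toLp 2 volume) (measurePreserving_sub_right volume a),
      (measurePreserving_sub_right volume a).quasiMeasurePreserving.ae_eq_comp
        ((𝓕 g).coeFn_toLp 2 volume)] with k h1 h2 h3
    rw [h1, h2, h3]
    rfl

end FourierMeasure

/-! ### Correlations along the relative momentum. -/

section Convolution

variable {G : Type*} [AddCommGroup G] [MeasurableSpace G] [MeasurableAdd₂ G] [MeasurableNeg G]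
  {ν : Measure G} [SFinite ν] [ν.IsAddLeftInvariant] [ν.IsNegInvariant]

/-- Integrating the correlation of `a` along the relative momentum amounts to integrating the
square of its fibre integrals over the total momentum. -/
lemma lintegral_lintegral_relative_shift {a : G × G → ℝ≥0∞} (ha : Measurable a) :
    ∫⁻ k, ∫⁻ z, a z * a (z.1 - k, z.2 + k) ∂(ν.prod ν) ∂ν =
      ∫⁻ P, (∫⁻ p, a (p, P - p) ∂ν) ^ 2 ∂ν := by
  have hsub : MeasurableSub₂ G := ⟨by simpa only [sub_eq_add_neg] using by fun_prop⟩
  calc ∫⁻ k, ∫⁻ z, a z * a (z.1 - k, z.2 + k) ∂(ν.prod ν) ∂ν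
    _ = ∫⁻ k, ∫⁻ p, ∫⁻ q, a (p, q) * a (p - k, q + k) ∂ν ∂ν ∂ν := by
      refine lintegral_congr fun k => ?_
      rw [lintegral_prod _ (by fun_prop)]
    _ = ∫⁻ p, ∫⁻ k, ∫⁻ q, a (p, q) * a (p - k, q + k) ∂ν ∂ν ∂ν :=
      lintegral_lintegral_swap (Measurable.lintegral_prod_right (by fun_prop)).aemeasurable
    -- Substitute `q = P - p`: the shift by `(-k, k)` preserves `P`. Next, `p' = p - k` decouples
    -- the two factors.
    _ = ∫⁻ p, ∫⁻ k, ∫⁻ P, a (p, P - p) * a (p - k, P - (p - k)) ∂ν ∂ν ∂ν := by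
      refine lintegral_congr fun p => lintegral_congr fun k => ?_
      rw [← lintegral_sub_right_eq_self _ p]
      simp only [sub_add, sub_sub_eq_add_sub]
    _ = ∫⁻ p, ∫⁻ P, a (p, P - p) * ∫⁻ p', a (p', P - p') ∂ν ∂ν ∂ν := by
      refine lintegral_congr fun p => ?_
      rw [lintegral_lintegral_swap (by fun_prop)]
      refine lintegral_congr fun P => ?_
      rw [lintegral_const_mul _ (by fun_prop),
        lintegral_sub_left_eq_self (fun p' => a (p', P - p')) p]
    _ = ∫⁻ P, ∫⁻ p, a (p, P - p) * ∫⁻ p', a (p', P - p') ∂ν ∂ν ∂ν := by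
      refine lintegral_lintegral_swap (Measurable.mul (by fun_prop) ?_).aemeasurable
      exact Measurable.lintegral_prod_right' (f := fun z : (G × G) × G => a (z.2, z.1.2 - z.2))
        (by fun_prop)
    _ = ∫⁻ P, (∫⁻ p, a (p, P - p) ∂ν) ^ 2 ∂ν := by
      refine lintegral_congr fun P => ?_
      rw [lintegral_mul_const _ (by fun_prop), sq]

/-- The correlation of `a` along the relative momentum is controlled by a weighted square
integral of `a`, for every product weight `r(p)² r(q)²` with `∫ r⁻⁴ < ∞`. -/
lemma lintegral_lintegral_relative_shift_le {a : G × G → ℝ≥0∞} (ha : Measurable a)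
    {r : G → ℝ≥0∞} (hr : Measurable r) (hr0 : ∀ p, r p ≠ 0) (hrt : ∀ p, r p ≠ ∞) :
    ∫⁻ k, ∫⁻ z, a z * a (z.1 - k, z.2 + k) ∂(ν.prod ν) ∂ν ≤
      (2 * ∫⁻ p, (r p)⁻¹ ^ 4 ∂ν) * ∫⁻ z, (a z * (r z.1 * r z.2)) ^ 2 ∂(ν.prod ν) := by
  have hsub : MeasurableSub₂ G := ⟨by simpa only [sub_eq_add_neg] using by fun_prop⟩
  rw [lintegral_lintegral_relative_shift ha]
  have hfib : ∀ P, (∫⁻ p, a (p, P - p) ∂ν) ^ 2 ≤ (2 * ∫⁻ p, (r p)⁻¹ ^ 4 ∂ν) *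
      ∫⁻ p, (a (p, P - p) * (r p * r (P - p))) ^ 2 ∂ν := by
    intro P
    have hsplit : ∀ p, a (p, P - p) =
        (a (p, P - p) * (r p * r (P - p))) * ((r p)⁻¹ * (r (P - p))⁻¹) := fun p => by
      rw [← ENNReal.mul_inv (.inl (hr0 _)) (.inl (hrt _)), mul_assoc,
        ENNReal.mul_inv_cancel (mul_ne_zero (hr0 _) (hr0 _)) (ENNReal.mul_ne_top (hrt _) (hrt _)),
        mul_one]
    have hCS := ENNReal.lintegral_mul_le_Lp_mul_Lq ν Real.HolderConjugate.two_two
      (f := fun p => a (p, P - p) * (r p * r (P - p))) (g := fun p => (r p)⁻¹ * (r (P - p))⁻¹)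
      (by fun_prop) (by fun_prop)
    simp only [Pi.mul_apply, ← hsplit, ENNReal.rpow_two] at hCS
    -- From `(xy)² ≤ x⁴ + y⁴`; both terms have the same integral by invariance, so the bound is
    -- uniform in `P`.
    have hw : ∫⁻ p, ((r p)⁻¹ * (r (P - p))⁻¹) ^ 2 ∂ν ≤ 2 * ∫⁻ p, (r p)⁻¹ ^ 4 ∂ν := by
      calc ∫⁻ p, ((r p)⁻¹ * (r (P - p))⁻¹) ^ 2 ∂ν
        _ ≤ ∫⁻ p, ((r p)⁻¹ ^ 4 + (r (P - p))⁻¹ ^ 4) ∂ν := by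
          refine lintegral_mono fun p => ?_
          rcases le_total (r p)⁻¹ (r (P - p))⁻¹ with h | h
          · calc ((r p)⁻¹ * (r (P - p))⁻¹) ^ 2 ≤ ((r (P - p))⁻¹ * (r (P - p))⁻¹) ^ 2 := by gcongr
              _ = (r (P - p))⁻¹ ^ 4 := by ring
              _ ≤ _ := le_add_self
          · calc ((r p)⁻¹ * (r (P - p))⁻¹) ^ 2 ≤ ((r p)⁻¹ * (r p)⁻¹) ^ 2 := by gcongr
              _ = (r p)⁻¹ ^ 4 := by ring
              _ ≤ _ := le_self_add
        _ = 2 * ∫⁻ p, (r p)⁻¹ ^ 4 ∂ν := by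
          rw [lintegral_add_left (by fun_prop),
            lintegral_sub_left_eq_self (fun p => (r p)⁻¹ ^ 4) P, two_mul]
    have hsq : ∀ x : ℝ≥0∞, (x ^ (1 / 2 : ℝ)) ^ 2 = x := fun x => by
      rw [← ENNReal.rpow_natCast, ← ENNReal.rpow_mul]; norm_num
    calc (∫⁻ p, a (p, P - p) ∂ν) ^ 2 ≤ _ := pow_le_pow_left' hCS 2
      _ = (∫⁻ p, (a (p, P - p) * (r p * r (P - p))) ^ 2 ∂ν) *
          ∫⁻ p, ((r p)⁻¹ * (r (P - p))⁻¹) ^ 2 ∂ν := by rw [mul_pow, hsq, hsq]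
      _ ≤ _ := by rw [mul_comm]; gcongr
  refine (lintegral_mono hfib).trans (le_of_eq ?_)
  rw [lintegral_const_mul _ (Measurable.lintegral_prod_right (by fun_prop)),
    lintegral_lintegral_swap (by fun_prop), lintegral_prod _ (by fun_prop)]
  congr 1
  refine lintegral_congr fun p => ?_
  rw [lintegral_sub_right_eq_self (fun q => (a (p, q) * (r p * r q)) ^ 2) p]

end Convolution

/-! ### Integrability of the weight. -/

section SymbolWeight

lemma oneSubLaplacianPowSymbol_pos (s : ℝ) (ξ : R3) : 0 < oneSubLaplacianPowSymbol s ξ := by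
  unfold oneSubLaplacianPowSymbol
  positivity

lemma measurable_oneSubLaplacianPowSymbol (s : ℝ) : Measurable (oneSubLaplacianPowSymbol s) := by
  unfold oneSubLaplacianPowSymbol
  fun_prop

lemma oneSubLaplacianPowSymbol_pow (s : ℝ) (n : ℕ) (ξ : R3) :
    oneSubLaplacianPowSymbol s ξ ^ n = oneSubLaplacianPowSymbol (s * n) ξ := by
  unfold oneSubLaplacianPowSymbol
  rw [← Real.rpow_natCast, ← Real.rpow_mul (by positivity)]

lemma oneSubLaplacianPowSymbol_neg (s : ℝ) (ξ : R3) :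
    oneSubLaplacianPowSymbol (-s) ξ = (oneSubLaplacianPowSymbol s ξ)⁻¹ :=
  Real.rpow_neg (by positivity) _

/-- The integrand is `(1 + |2πξ|²)^(-2s)`, of decay `|ξ|^(-4s)`; in dimension three this needs `4s >
3`, the origin of the exponent `3/4`. -/
lemma lintegral_oneSubLaplacianPowSymbol_inv_pow_lt_top {s : ℝ} (hs : 3 / 4 < s) :
    ∫⁻ ξ, (ENNReal.ofReal (oneSubLaplacianPowSymbol (s / 2) ξ))⁻¹ ^ 4 < ∞ := by
  have hint := integrable_rpow_neg_one_add_norm_sq (E := R3) (μ := volume) (r := 4 * s)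
    (by simp only [finrank_euclideanSpace, Fintype.card_fin]; push_cast; linarith)
  refine lt_of_le_of_lt (lintegral_mono fun ξ => ?_) hint.lintegral_lt_top
  rw [← ENNReal.ofReal_inv_of_pos (oneSubLaplacianPowSymbol_pos _ _),
    ← oneSubLaplacianPowSymbol_neg, ← ENNReal.ofReal_pow (oneSubLaplacianPowSymbol_pos _ _).le,
    oneSubLaplacianPowSymbol_pow]
  refine ENNReal.ofReal_le_ofReal ?_
  have hexp : -(s / 2) * (4 : ℕ) = -(4 * s) / 2 := by push_cast; ring
  rw [oneSubLaplacianPowSymbol, hexp]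
  refine Real.rpow_le_rpow_of_nonpos (by positivity) ?_ (by linarith)
  rw [mul_pow]
  have hpi : 1 ≤ (2 * Real.pi) ^ 2 := by nlinarith [Real.pi_gt_three]
  nlinarith [sq_nonneg ‖ξ‖]

end SymbolWeight

/-! ### The distribution of `x - y` and its Fourier transform. -/

section RelativePosition

/-- The distribution of the relative position `x - y` in the state `ψ`. -/
noncomputable def relativePositionMeasure (ψ : TwoBody) : Measure R3 :=
  (volume.withDensity fun z => ‖ψ z‖ₑ ^ 2).map fun z => z.fst - z.snd

lemma measurable_relativePosition : Measurable fun z : R3xR3 => z.fst - z.snd := by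
  have : Continuous fun z : R3xR3 => z.fst - z.snd := by fun_prop
  exact this.measurable

lemma measurable_enorm_sq (ψ : TwoBody) : Measurable fun z => ‖ψ z‖ₑ ^ 2 :=
  (Lp.stronglyMeasurable ψ).measurable.enorm.pow_const 2

instance (ψ : TwoBody) : IsFiniteMeasure (relativePositionMeasure ψ) := by
  have : IsFiniteMeasure (volume.withDensity fun z => ‖ψ z‖ₑ ^ 2) := by
    refine isFiniteMeasure_withDensity ?_
    have h := lintegral_rpow_enorm_lt_top_of_eLpNorm_lt_top two_ne_zero ENNReal.ofNat_ne_top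
      (Lp.memLp ψ).2
    simpa using h.ne
  exact Measure.isFiniteMeasure_map _ _

variable {E : Type*} [NormedAddCommGroup E] [NormedSpace ℝ E]

lemma integral_relativePositionMeasure (ψ : TwoBody) {h : R3 → E}
    (hh : AEStronglyMeasurable h (relativePositionMeasure ψ)) :
    ∫ u, h u ∂(relativePositionMeasure ψ) = ∫ z, ‖ψ z‖ ^ 2 • h (z.fst - z.snd) := by
  rw [relativePositionMeasure, integral_map measurable_relativePosition.aemeasurable hh,
    integral_withDensity_eq_integral_toReal_smul (measurable_enorm_sq ψ)
      (.of_forall fun z => by simp)]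
  simp

lemma integrable_relativePositionMeasure_iff (ψ : TwoBody) {h : R3 → E}
    (hh : AEStronglyMeasurable h (relativePositionMeasure ψ)) :
    Integrable h (relativePositionMeasure ψ) ↔
      Integrable fun z => ‖ψ z‖ ^ 2 • h (z.fst - z.snd) := by
  rw [relativePositionMeasure, integrable_map_measure hh measurable_relativePosition.aemeasurable,
    integrable_withDensity_iff_integrable_smul' (measurable_enorm_sq ψ)
      (.of_forall fun z => by simp)]
  simp

/-- The Fourier transform of the distribution of the relative position is the correlation of the
momentum wave function along the relative momentum. -/
lemma fourierInvMeasure_relativePositionMeasure (ψ : TwoBody) (k : R3) :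
    fourierInvMeasure (relativePositionMeasure ψ) k =
      ∫ z, starRingEnd ℂ (𝓕 ψ z) * 𝓕 ψ (z - WithLp.toLp 2 (k, -k)) := by
  -- `⟪x - y, k⟫ = ⟪a, z⟫`, so the transform is the expectation of a character; Plancherel turns it
  -- into a translation by `a`.
  set a : R3xR3 := WithLp.toLp 2 (k, -k)
  have hinner : ∀ z : R3xR3, (inner ℝ (z.fst - z.snd) k : ℝ) = inner ℝ a z := fun z => by
    simp [a, WithLp.prod_inner_apply, real_inner_comm k, sub_eq_add_neg, inner_add_right]
  calc fourierInvMeasure (relativePositionMeasure ψ) k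
    _ = ∫ z, ‖ψ z‖ ^ 2 • (Real.fourierChar (inner ℝ (z.fst - z.snd) k) : ℂ) := by
      rw [fourierInvMeasure_apply, integral_relativePositionMeasure]
      exact (Continuous.aestronglyMeasurable (by fun_prop))
    _ = inner ℂ ψ (characterLp a • ψ : TwoBody) := by
      rw [L2.inner_def]
      refine integral_congr_ae ?_
      filter_upwards [Lp.coeFn_lpSMul (r := 2) (characterLp a) ψ, coeFn_characterLp a]
        with z h1 h2
      rw [h1, Pi.smul_apply', h2, hinner, RCLike.inner_apply, smul_eq_mul, mul_assoc,
        Complex.mul_conj, Complex.normSq_eq_norm_sq, mul_comm]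
      rfl
    _ = inner ℂ (𝓕 ψ) (𝓕 (characterLp a • ψ : TwoBody)) := (Lp.inner_fourier_eq _ _).symm
    _ = ∫ z, starRingEnd ℂ (𝓕 ψ z) * 𝓕 ψ (z - a) := by
      rw [fourier_characterLp_smul, L2.inner_def]
      refine integral_congr_ae ?_
      filter_upwards [Lp.coeFn_compMeasurePreserving (𝓕 ψ) (measurePreserving_sub_right volume a)]
        with z h1
      rw [h1, RCLike.inner_apply, mul_comm]
      rfl

/-- Apply the correlation estimate to `|𝓕 ψ|` with `r` the symbol of exponent `s / 2`, so that `r²`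
is the symbol of exponent `s`. -/
lemma lintegral_enorm_fourierInvMeasure_relativePositionMeasure_le (ψ : TwoBody) (s : ℝ) :
    ∫⁻ k, ‖fourierInvMeasure (relativePositionMeasure ψ) k‖ₑ ≤
      (2 * ∫⁻ ξ, (ENNReal.ofReal (oneSubLaplacianPowSymbol (s / 2) ξ))⁻¹ ^ 4) *
        ∫⁻ ζ : R3xR3, ENNReal.ofReal (oneSubLaplacianPowSymbol s ζ.fst *
          oneSubLaplacianPowSymbol s ζ.snd * ‖𝓕 ψ ζ‖ ^ 2) := by
  have hφ : Measurable fun z : R3xR3 => ‖𝓕 ψ z‖ₑ :=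
    (Lp.stronglyMeasurable (𝓕 ψ)).measurable.enorm
  have hpres := WithLp.volume_preserving_toLp R3 R3
  have hsym := measurable_oneSubLaplacianPowSymbol
  have hfst : Measurable fun ζ : R3xR3 => ζ.fst := by
    have : Continuous fun ζ : R3xR3 => ζ.fst := by fun_prop
    exact this.measurable
  have hsnd : Measurable fun ζ : R3xR3 => ζ.snd := by
    have : Continuous fun ζ : R3xR3 => ζ.snd := by fun_prop
    exact this.measurable
  have hmain := lintegral_lintegral_relative_shift_le (ν := (volume : Measure R3))
    (a := fun z : R3 × R3 => ‖𝓕 ψ (WithLp.toLp 2 z)‖ₑ) (hφ.comp hpres.measurable)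
    (r := fun p => ENNReal.ofReal (oneSubLaplacianPowSymbol (s / 2) p)) (hsym _).ennreal_ofReal
    (fun p => by simpa using oneSubLaplacianPowSymbol_pos _ _) (fun p => ENNReal.ofReal_ne_top)
  refine (lintegral_mono fun k => ?_).trans (hmain.trans_eq ?_)
  · rw [fourierInvMeasure_relativePositionMeasure]
    refine (enorm_integral_le_lintegral_enorm _).trans_eq ?_
    rw [← hpres.lintegral_comp]
    · refine lintegral_congr fun z => ?_
      simp only [enorm_mul, RCLike.enorm_conj]
      congr 3
      rw [sub_eq_add_neg, ← WithLp.toLp_neg, ← WithLp.toLp_add]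
      simp only [Prod.neg_mk, neg_neg, sub_eq_add_neg]
      rfl
    · have hcont : Continuous fun z : R3xR3 => z - WithLp.toLp 2 (k, -k) := by fun_prop
      have hconj : Measurable fun z => starRingEnd ℂ (𝓕 ψ z) :=
        Complex.continuous_conj.measurable.comp (Lp.stronglyMeasurable (𝓕 ψ)).measurable
      exact (hconj.mul ((Lp.stronglyMeasurable (𝓕 ψ)).measurable.comp hcont.measurable)).enorm
  · congr 1
    rw [← hpres.lintegral_comp]
    · refine lintegral_congr fun z => ?_
      have hsq : ∀ p : R3, oneSubLaplacianPowSymbol s p = oneSubLaplacianPowSymbol (s / 2) p ^ 2 :=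
        fun p => by rw [oneSubLaplacianPowSymbol_pow]; norm_num
      have hnn := fun p => (oneSubLaplacianPowSymbol_pos (s / 2) p).le
      rw [← ofReal_norm, ← ENNReal.ofReal_mul (hnn _), ← ENNReal.ofReal_mul (norm_nonneg _),
        ← ENNReal.ofReal_pow (mul_nonneg (norm_nonneg _) (mul_nonneg (hnn _) (hnn _))), hsq, hsq]
      congr 1
      rw [WithLp.toLp_fst, WithLp.toLp_snd]
      ring
    · have hnorm : Measurable fun z : R3xR3 => ‖𝓕 ψ z‖ :=
        (Lp.stronglyMeasurable (𝓕 ψ)).measurable.norm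
      exact ((((hsym s).comp hfst).mul ((hsym s).comp hsnd)).mul (hnorm.pow_const 2)).ennreal_ofReal

/-- The two-body estimate `∫ |F| ≤ C ⟨ψ, (1 - Δ_x)^s ⊗ (1 - Δ_y)^s ψ⟩` for the Fourier transform
`F` of the distribution of the relative position. -/
lemma exists_integral_norm_fourierInvMeasure_relativePositionMeasure_le {s : ℝ} (hs : 3 / 4 < s) :
    ∃ C : ℝ, 0 < C ∧ ∀ ψ ∈ (oneSubLaplacianPowTensor s s).dom,
      Integrable (fourierInvMeasure (relativePositionMeasure ψ)) ∧
      ∫ k, ‖fourierInvMeasure (relativePositionMeasure ψ) k‖ ≤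
        C * (oneSubLaplacianPowTensor s s).val ψ := by
  set c := 2 * ∫⁻ ξ, (ENNReal.ofReal (oneSubLaplacianPowSymbol (s / 2) ξ))⁻¹ ^ 4
  have hc : c ≠ ∞ :=
    ENNReal.mul_ne_top ENNReal.ofNat_ne_top (lintegral_oneSubLaplacianPowSymbol_inv_pow_lt_top hs).ne
  -- The `+ 1` only secures strict positivity.
  refine ⟨c.toReal + 1, by positivity, fun ψ hψ => ?_⟩
  have hψ' : Integrable (fun ζ : R3xR3 => oneSubLaplacianPowSymbol s ζ.fst *
          oneSubLaplacianPowSymbol s ζ.snd * ‖𝓕 ψ ζ‖ ^ 2) := hψ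
  have hnonneg : ∀ ζ : R3xR3, 0 ≤ oneSubLaplacianPowSymbol s ζ.fst *
          oneSubLaplacianPowSymbol s ζ.snd * ‖𝓕 ψ ζ‖ ^ 2 := fun ζ =>
    mul_nonneg (mul_pos (oneSubLaplacianPowSymbol_pos _ _) (oneSubLaplacianPowSymbol_pos _ _)).le
      (sq_nonneg _)
  have hval : 0 ≤ (oneSubLaplacianPowTensor s s).val ψ := integral_nonneg hnonneg
  have hle := lintegral_enorm_fourierInvMeasure_relativePositionMeasure_le ψ s
  rw [← ofReal_integral_eq_lintegral_ofReal hψ' (.of_forall hnonneg)] at hle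
  have hle' : ∫⁻ k, ‖fourierInvMeasure (relativePositionMeasure ψ) k‖ₑ ≤
    c * ENNReal.ofReal ((oneSubLaplacianPowTensor s s).val ψ) := hle
  have hfin : c * ENNReal.ofReal ((oneSubLaplacianPowTensor s s).val ψ) ≠ ∞ :=
    ENNReal.mul_ne_top hc ENNReal.ofReal_ne_top
  refine ⟨⟨(continuous_fourierInvMeasure _).aestronglyMeasurable, hle'.trans_lt hfin.lt_top⟩, ?_⟩
  rw [integral_norm_eq_lintegral_enorm (continuous_fourierInvMeasure _).aestronglyMeasurable]
  calc _ ≤ (c * ENNReal.ofReal ((oneSubLaplacianPowTensor s s).val ψ)).toReal :=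
        ENNReal.toReal_mono hfin hle'
    _ = c.toReal * (oneSubLaplacianPowTensor s s).val ψ := by
      rw [ENNReal.toReal_mul, ENNReal.toReal_ofReal hval]
    _ ≤ _ := by gcongr; linarith

end RelativePosition

/-! ### From the relative-position distribution to the form bound. -/

section PairInteraction

/-- The pair interaction is form bounded by the Fourier transform of the distribution of the
relative position. -/
lemma pairInteraction_of_integrable_fourierInvMeasure {W : R3 → ℝ}
    (hW : MemLp W 2 (volume : Measure R3))
    (hWinf : MemLp (fourierL2 W hW) ∞ (volume : Measure R3)) {ψ : TwoBody}
    (hF : Integrable (fourierInvMeasure (relativePositionMeasure ψ))) :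
    ψ ∈ (pairInteraction W).dom ∧
      |(pairInteraction W).val ψ| ≤ (eLpNorm (fourierL2 W hW) ∞ (volume : Measure R3)).toReal *
        ∫ k, ‖fourierInvMeasure (relativePositionMeasure ψ) k‖ := by
  set μ := relativePositionMeasure ψ
  have hle := measure_le_smul_volume_of_integrable_fourierInvMeasure hF
  have hac : μ ≪ volume := Measure.absolutelyContinuous_of_le_smul hle
  -- Domination puts `W` in `L²(μ)`, and finiteness of `μ` then gives `L¹(μ)`: this is the
  -- form-domain claim.
  have hWμ : MemLp W 2 μ := hW.of_measure_le_smul ENNReal.ofReal_ne_top hle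
  have hWint : Integrable W μ := hWμ.integrable one_le_two
  constructor
  · have h := (integrable_relativePositionMeasure_iff ψ hWint.1).1 hWint
    simp only [smul_eq_mul, mul_comm (‖_‖ ^ 2)] at h
    exact h
  · have hval : (pairInteraction W).val ψ = ∫ u, W u ∂μ := by
      rw [integral_relativePositionMeasure ψ hWint.1]
      simp only [smul_eq_mul, mul_comm (‖_‖ ^ 2)]
      rfl
    have hpars := integral_eq_integral_fourier_mul hF
      (MemLp.toLp (fun x => (W x : ℂ)) hW.ofReal)
    rw [integral_congr_ae (hac.ae_eq (MemLp.coeFn_toLp hW.ofReal)), integral_complex_ofReal]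
      at hpars
    rw [hval, ← Real.norm_eq_abs, ← Complex.norm_real, hpars, ← integral_const_mul]
    refine norm_integral_le_of_norm_le (hF.norm.const_mul _) ?_
    filter_upwards [ae_le_eLpNormEssSup (f := fourierL2 W hW) (μ := volume)] with k hk
    rw [norm_mul]
    gcongr
    rw [← toReal_enorm]
    exact ENNReal.toReal_mono hWinf.2.ne (by rwa [eLpNorm_exponent_top])

end PairInteraction

theorem lemma9 (ε : ℝ) (hε : 0 < ε) :
    ∃ C : ℝ, 0 < C ∧
      ∀ (W : R3 → ℝ) (hW : MemLp W 2 (volume : Measure R3)),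
        MemLp (fourierL2 W hW) ∞ (volume : Measure R3) →
          (pairInteraction W).OpLE
            ((oneSubLaplacianPowTensor (3 / 4 + ε) (3 / 4 + ε)).scale
              (C * (eLpNorm (fourierL2 W hW) ∞ (volume : Measure R3)).toReal)) ∧
          (pairInteraction (fun x => -W x)).OpLE
            ((oneSubLaplacianPowTensor (3 / 4 + ε) (3 / 4 + ε)).scale
              (C * (eLpNorm (fourierL2 W hW) ∞ (volume : Measure R3)).toReal)) := by
  obtain ⟨C, hC, hbound⟩ :=
    exists_integral_norm_fourierInvMeasure_relativePositionMeasure_le (s := 3 / 4 + ε) (by linarith)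
  refine ⟨C, hC, fun W hW hWinf => ?_⟩
  -- Bounding the absolute value treats both signs of `W` at once.
  have key : ∀ ψ ∈ (oneSubLaplacianPowTensor (3 / 4 + ε) (3 / 4 + ε)).dom,
      ψ ∈ (pairInteraction W).dom ∧ |(pairInteraction W).val ψ| ≤
        C * (eLpNorm (fourierL2 W hW) ∞ (volume : Measure R3)).toReal *
          (oneSubLaplacianPowTensor (3 / 4 + ε) (3 / 4 + ε)).val ψ := by
    intro ψ hψ
    obtain ⟨hF, hFle⟩ := hbound ψ hψ
    obtain ⟨hdom, hval⟩ := pairInteraction_of_integrable_fourierInvMeasure hW hWinf hF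
    refine ⟨hdom, hval.trans ?_⟩
    rw [mul_comm C, mul_assoc]
    gcongr
  refine ⟨fun ψ hψ => ⟨(key ψ hψ).1, (le_abs_self _).trans (key ψ hψ).2⟩, fun ψ hψ => ⟨?_, ?_⟩⟩
  · have hint : Integrable fun z : R3xR3 => W (z.fst - z.snd) * ‖ψ z‖ ^ 2 := (key ψ hψ).1
    have hneg : Integrable fun z : R3xR3 => -W (z.fst - z.snd) * ‖ψ z‖ ^ 2 := by
      simp only [neg_mul]
      exact hint.neg
    exact hneg
  · have hneg : (pairInteraction fun x => -W x).val ψ = -(pairInteraction W).val ψ := by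
      simp only [pairInteraction, TwoBodyForm.multiplication, neg_mul, integral_neg]
    rw [hneg]
    exact (neg_le_abs _).trans (key ψ hψ).2
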